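/- Conventions. Let $G$ be a finite group and $\mathcal{D}$ a triangulated category with shift $[1]$. A (right) \emph{action} of $G$ on $\mathcal{D}$ consists of additive autoequivalences $F_g$ ($g\in G$) and natural isomorphisms $\delta_{g,h}\colon F_gF_h\to F_{hg}$ such that $\delta_{g,lh}\circ F_g\delta_{h,l}=\delta_{hg,l}\circ\delta_{g,h}F_l$ for all $g,h,l\in G$. It is \emph{admissible} if each $F_g$ is an exact functor, with commutation isomorphisms $F_g\circ[1]\cong[1]\circ F_g$ compatible with all $\delta_{g,h}$. The category $\mathcal{D}^G$ of equivariant objects has as objects the pairs $X=(A,\{\lambda_g\})$ with $A\in\mathcal{D}$ and isomorphisms $\lambda_g\colon F_g(A)\to A$ such that $\lambda_g\circ F_g(\lambda_h)=\lambda_{hg}\circ\delta_{g,h,A}$; $G$ acts on the right on $\mathrm{Hom}_{\mathcal{D}}(A,B)$, for equivariant objects $(A,\{\lambda^A_g\})$ and $(B,\{\lambda^B_g\})$, by $f.g=\lambda^B_g\circ F_g(f)\circ(\lambda^A_g)^{-1}$, and the morphisms of $\mathcal{D}^G$ are the $G$-invariant morphisms. Let $\omega\colon\mathcal{D}^G\to\mathcal{D}$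 be the forgetful functor and $\mathrm{Ind}\colon\mathcal{D}\to\mathcal{D}^G$ the induction functor, $\mathrm{Ind}(A)=\bigoplus_{h\in G}F_h(A)$ with the equivariant structure induced by the isomorphisms $\delta_{g,h}\colon F_gF_h(A)\to F_{hg}(A)$. The shift of $\mathcal{D}$ induces a shift of $\mathcal{D}^G$. A triangulated structure on $\mathcal{D}^G$ with this shift is \emph{canonical} if $\omega$ is exact. An object $T$ of a triangulated category is \emph{tilting} if $\mathrm{Hom}(T,T[n])=0$ for all $n\neq 0$ and the thick closure of $T$ is the whole category. It is \emph{$G$-invariant} if $F_g(T)\cong T$ for all $g\in G$. For an equivariant object $X$, the skew group ring $\mathrm{End}_{\mathcal{D}}(\omega X)G$ is the free left $\mathrm{End}_{\mathcal{D}}(\omega X)$-module with basis $G$ and multiplication $(ag)(a'g')=a\,(a'.g^{-1})\,gg'$. Write $\mathrm{gl.dim}\,R$ for the right global dimension of a ring $R$. \textbf{Proposition.} Let $G$ be a finite group and $\mathcal{D}$ an idempotent-complete triangulated category with an admissible action of $G$ such that $|G|$ is invertible in $\mathcal{D}$ (for each morphism $f$ there is a unique morphism $f'$ with $|G|f'=f$)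 and such that $\mathcal{D}^G$ admits a canonical triangulated structure, with which it is equipped. Let $T$ be a $G$-invariant tilting object of $\mathcal{D}$. Then $\mathrm{Ind}(T)$ is a tilting object of $\mathcal{D}^G$; its endomorphism ring $\mathrm{End}_{\mathcal{D}^G}(\mathrm{Ind}(T))$ is Morita equivalent to the skew group ring $\mathrm{End}_{\mathcal{D}}(\omega\,\mathrm{Ind}(T))G$; and \[\mathrm{gl.dim}\,\mathrm{End}_{\mathcal{D}^G}(\mathrm{Ind}(T))=\mathrm{gl.dim}\,\mathrm{End}_{\mathcal{D}}(T).\] -/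

import Mathlib

open CategoryTheory CategoryTheory.Limits CategoryTheory.Pretriangulated

universe w v u

noncomputable section

namespace Equivariantization

/-- A (right) action of a group `G` on an additive category `A`: additive autoequivalences `F g`
and natural isomorphisms `δ g h : F g ∘ F h ≅ F (h * g)` satisfying the `2`-cocycle condition
`δ_{g, lh} ∘ F_g(δ_{h,l}) = δ_{hg, l} ∘ δ_{g,h} F_l`.
(Note that `F h ⋙ F g` is the functor `X ↦ F g (F h X)`; the `eqToHom` below only identifies
`l * h * g` with `l * (h * g)`.) -/
structure GroupAction (G : Type w) [Group G] (A : Type u) [Category.{v} A] [Preadditive A] where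
  F : G → A ⥤ A
  isEquivalence : ∀ g, (F g).IsEquivalence
  additive : ∀ g, (F g).Additive
  δ : ∀ g h : G, F h ⋙ F g ≅ F (h * g)
  cocycle : ∀ (g h l : G) (X : A),
    (F g).map ((δ h l).hom.app X) ≫ (δ g (l * h)).hom.app X ≫
        eqToHom (by rw [mul_assoc]) =
      (δ g h).hom.app ((F l).obj X) ≫ (δ (h * g) l).hom.app X

section Additive

variable {G : Type w} [Group G] {A : Type u} [Category.{v} A] [Preadditive A]

instance (𝒢 : GroupAction G A) (g : G) : (𝒢.F g).IsEquivalence := 𝒢.isEquivalence g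

instance (𝒢 : GroupAction G A) (g : G) : (𝒢.F g).Additive := 𝒢.additive g

/-- An object `B` is `G`-invariant if `F g B ≅ B` for every `g`. -/
def GroupAction.IsInvariant (𝒢 : GroupAction G A) (B : A) : Prop :=
  ∀ g : G, Nonempty ((𝒢.F g).obj B ≅ B)

/-- The natural number `n` is invertible in the category `A`: every morphism is uniquely
divisible by `n`. -/
def IsInvertibleIn (n : ℕ) (A : Type u) [Category.{v} A] [Preadditive A] : Prop :=
  ∀ ⦃X Y : A⦄ (f : X ⟶ Y), ∃! g : X ⟶ Y, n • g = f

/-- A `G`-equivariant object: an object `X` with isomorphisms `lam g : F g X ≅ X` such that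
`lam g ∘ F g (lam h) = lam (h * g) ∘ δ g h`. These are the objects of the
equivariantization `A^G`. -/
structure EquivariantObject (𝒢 : GroupAction G A) where
  obj : A
  lam : ∀ g : G, (𝒢.F g).obj obj ≅ obj
  comm : ∀ g h : G, (𝒢.F g).map (lam h).hom ≫ (lam g).hom =
    (𝒢.δ g h).hom.app obj ≫ (lam (h * g)).hom

variable {𝒢 : GroupAction G A}

/-- The right action of `G` on morphisms between the underlying objects of two equivariant
objects: `f.g = lam_g^Y ∘ F_g(f) ∘ (lam_g^X)⁻¹`. -/
def conj {X Y : EquivariantObject 𝒢} (g : G) (f : X.obj ⟶ Y.obj) : X.obj ⟶ Y.obj :=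
  (X.lam g).inv ≫ (𝒢.F g).map f ≫ (Y.lam g).hom

/-- A morphism of equivariant objects is a `G`-invariant morphism of the underlying objects. -/
@[ext]
structure EquivariantHom (X Y : EquivariantObject 𝒢) where
  hom : X.obj ⟶ Y.obj
  invariant : ∀ g : G, conj g hom = hom

lemma conj_eq_iff {X Y : EquivariantObject 𝒢} (g : G) (f f' : X.obj ⟶ Y.obj) :
    conj g f = f' ↔ (𝒢.F g).map f ≫ (Y.lam g).hom = (X.lam g).hom ≫ f' := by
  rw [conj, Iso.inv_comp_eq]

lemma conj_id (X : EquivariantObject 𝒢) (g : G) : conj g (𝟙 X.obj) = 𝟙 X.obj := by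
  simp [conj]

lemma conj_comp {X Y Z : EquivariantObject 𝒢} (g : G) (f : X.obj ⟶ Y.obj) (f' : Y.obj ⟶ Z.obj) :
    conj g (f ≫ f') = conj (X := X) (Y := Y) g f ≫ conj (X := Y) (Y := Z) g f' := by
  simp [conj]

lemma conj_add {X Y : EquivariantObject 𝒢} (g : G) (f f' : X.obj ⟶ Y.obj) :
    conj g (f + f') = conj g f + conj g f' := by
  simp [conj, Functor.map_add]

/-- `(f.h).g = f.(hg)`. -/
lemma conj_conj {X Y : EquivariantObject 𝒢} (g h : G) (f : X.obj ⟶ Y.obj) :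
    conj g (conj h f) = conj (X := X) (Y := Y) (h * g) f := by
  rw [conj_eq_iff, ← cancel_epi ((𝒢.F g).map (X.lam h).hom), ← Functor.map_comp_assoc,
    (conj_eq_iff h f (conj h f)).1 rfl |>.symm, Functor.map_comp, Category.assoc, Y.comm,
    ← Category.assoc ((𝒢.F g).map (X.lam h).hom), X.comm, Category.assoc,
    ← (conj_eq_iff (h * g) f (conj (h * g) f)).1 rfl]
  exact (𝒢.δ g h).hom.naturality_assoc f _

lemma conj_one {X Y : EquivariantObject 𝒢} (f : X.obj ⟶ Y.obj) :
    conj (X := X) (Y := Y) 1 f = f := by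
  have h : conj (X := X) (Y := Y) 1 (conj (X := X) (Y := Y) 1 f) =
      conj (X := X) (Y := Y) 1 f := by
    rw [conj_conj, mul_one]
  have inj : Function.Injective (conj (X := X) (Y := Y) (1 : G)) := by
    intro a b hab
    simp only [conj, Iso.cancel_iso_inv_left, Iso.cancel_iso_hom_right] at hab
    exact (𝒢.F 1).map_injective hab
  exact inj h

instance : Category.{v} (EquivariantObject 𝒢) where
  Hom X Y := EquivariantHom X Y
  id X := ⟨𝟙 X.obj, conj_id X⟩
  comp f f' := ⟨f.hom ≫ f'.hom, fun g => by rw [conj_comp, f.invariant, f'.invariant]⟩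
  id_comp f := EquivariantHom.ext (Category.id_comp _)
  comp_id f := EquivariantHom.ext (Category.comp_id _)
  assoc f f' f'' := EquivariantHom.ext (Category.assoc _ _ _)

@[ext]
lemma hom_ext {X Y : EquivariantObject 𝒢} {f f' : X ⟶ Y} (h : f.hom = f'.hom) : f = f' :=
  EquivariantHom.ext h

@[simp] lemma id_hom (X : EquivariantObject 𝒢) : EquivariantHom.hom (𝟙 X) = 𝟙 X.obj := rfl

@[simp] lemma comp_hom {X Y Z : EquivariantObject 𝒢} (f : X ⟶ Y) (f' : Y ⟶ Z) :
    EquivariantHom.hom (f ≫ f') = f.hom ≫ f'.hom := rfl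

lemma eqToHom_hom {X Y : EquivariantObject 𝒢} (h : X = Y) :
    EquivariantHom.hom (eqToHom h) = eqToHom (congrArg EquivariantObject.obj h) := by
  subst h
  rfl

lemma hom_comm {X Y : EquivariantObject 𝒢} (f : X ⟶ Y) (g : G) :
    (𝒢.F g).map f.hom ≫ (Y.lam g).hom = (X.lam g).hom ≫ f.hom :=
  (conj_eq_iff g _ _).1 (f.invariant g)

/-- Build a morphism of equivariant objects from a commutation relation. -/
def mkHom {X Y : EquivariantObject 𝒢} (f : X.obj ⟶ Y.obj)
    (hf : ∀ g : G, (𝒢.F g).map f ≫ (Y.lam g).hom = (X.lam g).hom ≫ f) : X ⟶ Y :=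
  ⟨f, fun g => (conj_eq_iff g _ _).2 (hf g)⟩

@[simp] lemma mkHom_hom {X Y : EquivariantObject 𝒢} (f : X.obj ⟶ Y.obj)
    (hf : ∀ g : G, (𝒢.F g).map f ≫ (Y.lam g).hom = (X.lam g).hom ≫ f) :
    (mkHom f hf).hom = f := rfl

/-- Build an isomorphism of equivariant objects from a commutation relation. -/
def mkIso {X Y : EquivariantObject 𝒢} (e : X.obj ≅ Y.obj)
    (he : ∀ g : G, (𝒢.F g).map e.hom ≫ (Y.lam g).hom = (X.lam g).hom ≫ e.hom) : X ≅ Y where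
  hom := mkHom e.hom he
  inv := mkHom e.inv fun g => by
    rw [← cancel_epi ((𝒢.F g).map e.hom), ← Functor.map_comp_assoc, Iso.hom_inv_id,
      CategoryTheory.Functor.map_id, Category.id_comp, ← Category.assoc, he, Category.assoc,
      Iso.hom_inv_id, Category.comp_id]
  hom_inv_id := by ext; simp
  inv_hom_id := by ext; simp

@[simp] lemma mkIso_hom_hom {X Y : EquivariantObject 𝒢} (e : X.obj ≅ Y.obj)
    (he : ∀ g : G, (𝒢.F g).map e.hom ≫ (Y.lam g).hom = (X.lam g).hom ≫ e.hom) :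
    (mkIso e he).hom.hom = e.hom := rfl

@[simp] lemma mkIso_inv_hom {X Y : EquivariantObject 𝒢} (e : X.obj ≅ Y.obj)
    (he : ∀ g : G, (𝒢.F g).map e.hom ≫ (Y.lam g).hom = (X.lam g).hom ≫ e.hom) :
    (mkIso e he).inv.hom = e.inv := rfl

/-! ### The additive structure of `A^G`: addition of morphisms is that of `A` -/

lemma conj_zero {X Y : EquivariantObject 𝒢} (g : G) :
    conj (X := X) (Y := Y) g 0 = 0 := by
  simp [conj]

lemma conj_neg {X Y : EquivariantObject 𝒢} (g : G) (f : X.obj ⟶ Y.obj) :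
    conj (X := X) (Y := Y) g (-f) = -conj (X := X) (Y := Y) g f := by
  simp [conj, Functor.map_neg]

instance (X Y : EquivariantObject 𝒢) : Zero (X ⟶ Y) := ⟨⟨0, conj_zero⟩⟩

instance (X Y : EquivariantObject 𝒢) : Add (X ⟶ Y) :=
  ⟨fun f f' => ⟨f.hom + f'.hom, fun g => by rw [conj_add, f.invariant, f'.invariant]⟩⟩

instance (X Y : EquivariantObject 𝒢) : Neg (X ⟶ Y) :=
  ⟨fun f => ⟨-f.hom, fun g => by rw [conj_neg, f.invariant]⟩⟩

instance (X Y : EquivariantObject 𝒢) : AddCommGroup (X ⟶ Y) where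
  add_assoc f f' f'' := EquivariantHom.ext (add_assoc _ _ _)
  zero_add f := EquivariantHom.ext (zero_add _)
  add_zero f := EquivariantHom.ext (add_zero _)
  add_comm f f' := EquivariantHom.ext (add_comm _ _)
  neg_add_cancel f := EquivariantHom.ext (neg_add_cancel _)
  nsmul := nsmulRec
  zsmul := zsmulRec

instance : Preadditive (EquivariantObject 𝒢) where
  add_comp X Y Z f f' h := EquivariantHom.ext (Preadditive.add_comp _ _ _ _ _ _)
  comp_add X Y Z f h h' := EquivariantHom.ext (Preadditive.comp_add _ _ _ _ _ _)

@[simp] lemma add_hom {X Y : EquivariantObject 𝒢} (f f' : X ⟶ Y) :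
    EquivariantHom.hom (f + f') = f.hom + f'.hom := rfl

@[simp] lemma zero_hom {X Y : EquivariantObject 𝒢} :
    EquivariantHom.hom (0 : X ⟶ Y) = 0 := rfl

/-- The forgetful functor `ω : A^G ⥤ A`. -/
def forget (𝒢 : GroupAction G A) : EquivariantObject 𝒢 ⥤ A where
  obj X := X.obj
  map f := f.hom

instance : (forget 𝒢).Additive where

instance [HasZeroObject A] : HasZeroObject (EquivariantObject 𝒢) := by
  obtain ⟨Z, hZ⟩ := HasZeroObject.zero (C := A)
  let Z' : EquivariantObject 𝒢 :=
    { obj := Z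
      lam := fun g => ((𝒢.F g).map_isZero hZ).iso hZ
      comm := fun g h => hZ.eq_of_tgt _ _ }
  refine ⟨⟨Z', fun Y => ⟨⟨⟨0⟩, fun f => ?_⟩⟩, fun Y => ⟨⟨⟨0⟩, fun f => ?_⟩⟩⟩⟩
  · exact hom_ext (hZ.eq_of_src _ _)
  · exact hom_ext (hZ.eq_of_tgt _ _)

/-! ### The induction functor -/

section Ind

variable [HasFiniteBiproducts A] [Finite G]

instance (𝒢 : GroupAction G A) (g : G) (X : A) :
    PreservesBiproduct (fun h : G => (𝒢.F h).obj X) (𝒢.F g) :=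
  have := preservesBiproductsOfShape_of_preservesProductsOfShape (J := G) (𝒢.F g)
  inferInstance

/-- The isomorphism `F_g (⨁_h F_h X) ≅ ⨁_h F_g (F_h X) ≅ ⨁_k F_k X` which identifies the
summand `F_g (F_h X)` with the summand `F_{hg} X` by means of `δ g h`. -/
def indLam (𝒢 : GroupAction G A) (X : A) (g : G) :
    (𝒢.F g).obj (⨁ fun h : G => (𝒢.F h).obj X) ≅ ⨁ fun h : G => (𝒢.F h).obj X :=
  (𝒢.F g).mapBiproduct (fun h : G => (𝒢.F h).obj X) ≪≫
    biproduct.whiskerEquiv (f := fun h : G => (𝒢.F g).obj ((𝒢.F h).obj X))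
      (g := fun h : G => (𝒢.F h).obj X) (Equiv.mulRight g)
      (fun h => show (𝒢.F (h * g)).obj X ≅ (𝒢.F h ⋙ 𝒢.F g).obj X from
        ((𝒢.δ g h).app X).symm)

lemma ι_indLam (𝒢 : GroupAction G A) (X : A) (g h : G) :
    (𝒢.F g).map (biproduct.ι (fun h : G => (𝒢.F h).obj X) h) ≫ (indLam 𝒢 X g).hom =
      (𝒢.δ g h).hom.app X ≫ biproduct.ι (fun h : G => (𝒢.F h).obj X) (h * g) := by
  have h1 : (𝒢.F g).map (biproduct.ι (fun h : G => (𝒢.F h).obj X) h) ≫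
      ((𝒢.F g).mapBiproduct (fun h : G => (𝒢.F h).obj X)).hom =
      biproduct.ι (fun h : G => (𝒢.F g).obj ((𝒢.F h).obj X)) h := by
    rw [← Iso.eq_comp_inv, Functor.mapBiproduct_inv]
    exact (biproduct.ι_desc (f := fun h : G => (𝒢.F g).obj ((𝒢.F h).obj X))
      (fun j => (𝒢.F g).map (biproduct.ι (fun h : G => (𝒢.F h).obj X) j)) h).symm
  refine (Category.assoc _ _ _).symm.trans ((congrArg (· ≫ _) h1).trans ?_)
  exact biproduct.ι_desc (f := fun h : G => (𝒢.F g).obj ((𝒢.F h).obj X)) _ h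

lemma ι_indLam_assoc (𝒢 : GroupAction G A) (X : A) (g h : G) {Y : A}
    (f : (⨁ fun h : G => (𝒢.F h).obj X) ⟶ Y) :
    (𝒢.F g).map (biproduct.ι (fun h : G => (𝒢.F h).obj X) h) ≫ (indLam 𝒢 X g).hom ≫ f =
      (𝒢.δ g h).hom.app X ≫ biproduct.ι (fun h : G => (𝒢.F h).obj X) (h * g) ≫ f := by
  rw [← Category.assoc, ι_indLam, Category.assoc]

/-- Morphisms out of `F_g (⨁_h F_h X)` are determined on the summands. -/
lemma map_biproduct_hom_ext (𝒢 : GroupAction G A) (X Y : A) (g : G)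
    {f f' : (𝒢.F g).obj (⨁ fun h : G => (𝒢.F h).obj X) ⟶ Y}
    (w : ∀ h, (𝒢.F g).map (biproduct.ι (fun h : G => (𝒢.F h).obj X) h) ≫ f =
      (𝒢.F g).map (biproduct.ι (fun h : G => (𝒢.F h).obj X) h) ≫ f') : f = f' := by
  rw [← cancel_epi ((𝒢.F g).mapBiproduct (fun h : G => (𝒢.F h).obj X)).inv]
  refine biproduct.hom_ext' _ _ fun h => ?_
  rw [Functor.mapBiproduct_inv, biproduct.ι_desc_assoc, biproduct.ι_desc_assoc]
  exact w h

/-- The induction functor `Ind : A ⥤ A^G`, `X ↦ ⨁_h F_h X`. -/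
def Ind (𝒢 : GroupAction G A) : A ⥤ EquivariantObject 𝒢 where
  obj X :=
    { obj := ⨁ fun h : G => (𝒢.F h).obj X
      lam := indLam 𝒢 X
      comm := fun g h => by
        have : (𝒢.F h ⋙ 𝒢.F g).IsEquivalence := inferInstance
        rw [← cancel_epi ((𝒢.δ g h).inv.app _), Iso.inv_hom_id_app_assoc]
        refine map_biproduct_hom_ext 𝒢 X _ _ fun l => ?_
        rw [ι_indLam, ← Category.assoc, (𝒢.δ g h).inv.naturality, Category.assoc,
          Functor.comp_map, ← Functor.map_comp_assoc, ι_indLam, Functor.map_comp, Category.assoc,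
          ι_indLam, ← cancel_epi ((𝒢.δ g h).hom.app _), Iso.hom_inv_id_app_assoc,
          ← Category.assoc ((𝒢.δ g h).hom.app _), ← 𝒢.cocycle]
        simp only [Category.assoc]
        congr 2
        exact (biproduct.eqToHom_comp_ι (fun h : G => (𝒢.F h).obj X) (mul_assoc l h g)).symm }
  map {X Y} f := mkHom (biproduct.map fun h => (𝒢.F h).map f) fun g => by
    refine map_biproduct_hom_ext 𝒢 X _ g fun h => ?_
    rw [← Functor.map_comp_assoc, biproduct.ι_map, Functor.map_comp, Category.assoc, ι_indLam,
      ι_indLam_assoc, biproduct.ι_map, ← Category.assoc, ← Category.assoc]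
    congr 1
    exact (𝒢.δ g h).hom.naturality f
  map_id X := by ext : 2; simp
  map_comp f f' := by ext : 2; simp

end Ind

/-! ### The action of `G` on endomorphism rings -/

/-- The left action of `G` by ring automorphisms on the endomorphism ring (in `A`) of an
equivariant object which corresponds to the right action `f ↦ f.g`, that is
`g • f = f.(g⁻¹)`. With this action `SkewMonoidAlgebra (End X.obj) G` is the skew group ring
`End(X) G`: its multiplication is `(a g) (a' g') = a (a'.(g⁻¹)) (g g')`. -/
instance (X : EquivariantObject 𝒢) : MulSemiringAction G (End X.obj) where
  smul g f := conj (X := X) (Y := X) g⁻¹ f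
  one_smul f := by
    change conj (X := X) (Y := X) (1 : G)⁻¹ f = f
    rw [inv_one, conj_one]
  mul_smul g h f := by
    change conj (X := X) (Y := X) (g * h)⁻¹ f =
      conj (X := X) (Y := X) g⁻¹ (conj (X := X) (Y := X) h⁻¹ f)
    rw [conj_conj, mul_inv_rev]
  smul_zero g := conj_zero _
  smul_add g f f' := conj_add _ _ _
  smul_one g := conj_id _ _
  smul_mul g f f' := conj_comp _ _ _

/-- The skew group ring `End_A(ω X) G` of an equivariant object `X`; its elements are the formal
sums `∑ a_g g` with `a_g ∈ End_A(ω X)`. -/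
abbrev SkewGroupRing (X : EquivariantObject 𝒢) : Type (max v w) :=
  SkewMonoidAlgebra (End X.obj) G

lemma smul_end_def (X : EquivariantObject 𝒢) (g : G) (f : End X.obj) :
    g • f = conj (X := X) (Y := X) g⁻¹ f := rfl

end Additive

section Triangulated

variable {G : Type w} [Group G] {D : Type u} [Category.{v} D] [Preadditive D] [HasZeroObject D]
  [HasShift D ℤ] [∀ n : ℤ, (shiftFunctor D n).Additive] [Pretriangulated D]

/-- An admissible action on a triangulated category: each `F g` is an exact functor, with
commutation isomorphisms `F_g (X⟦n⟧) ≅ (F_g X)⟦n⟧` that are compatible with `δ`. -/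
class AdmissibleAction (𝒢 : GroupAction G D) where
  commShift : ∀ g, (𝒢.F g).CommShift ℤ
  isTriangulated : ∀ g, (𝒢.F g).IsTriangulated
  δ_commShift : ∀ g h, NatTrans.CommShift (𝒢.δ g h).hom ℤ

variable (𝒢 : GroupAction G D) [AdmissibleAction 𝒢]

instance (g : G) : (𝒢.F g).CommShift ℤ := AdmissibleAction.commShift g

instance (g : G) : (𝒢.F g).IsTriangulated := AdmissibleAction.isTriangulated g

instance (g h : G) : NatTrans.CommShift (𝒢.δ g h).hom ℤ := AdmissibleAction.δ_commShift g h

/-- The shift functors of `D^G`: `X⟦n⟧` has the equivariant structure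
`F_g (X⟦n⟧) ≅ (F_g X)⟦n⟧ ≅ X⟦n⟧`. -/
def equivariantShift (n : ℤ) : EquivariantObject 𝒢 ⥤ EquivariantObject 𝒢 where
  obj X :=
    { obj := X.obj⟦n⟧
      lam := fun g => ((𝒢.F g).commShiftIso n).app X.obj ≪≫
        (shiftFunctor D n).mapIso (X.lam g)
      comm := fun g h => by
        have h1 := NatTrans.shift_app_comm (𝒢.δ g h).hom n X.obj
        have h2 := congrArg (fun f => f⟦n⟧') (X.comm g h)
        simp only [Functor.map_comp] at h2
        simp only [Iso.trans_hom, Iso.app_hom, Functor.mapIso_hom, Functor.map_comp,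
          Category.assoc]
        rw [Functor.commShiftIso_hom_naturality_assoc, h2]
        rw [Functor.commShiftIso_comp_hom_app, Category.assoc] at h1
        rw [reassoc_of% h1] }
  map f := mkHom (f.hom⟦n⟧') fun g => by
    simp only [Iso.trans_hom, Iso.app_hom, Functor.mapIso_hom, Category.assoc]
    rw [Functor.commShiftIso_hom_naturality_assoc, ← Functor.map_comp, hom_comm,
      Functor.map_comp]
  map_id X := by ext : 1; simp
  map_comp f f' := by ext : 1; simp

lemma equivariantShift_obj_lam_hom (n : ℤ) (X : EquivariantObject 𝒢) (g : G) :
    (((equivariantShift 𝒢 n).obj X).lam g).hom =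
      ((𝒢.F g).commShiftIso n).hom.app X.obj ≫ ((X.lam g).hom)⟦n⟧' := rfl

/-- The isomorphism `X⟦0⟧ ≅ X` in `D^G`. -/
def equivariantShiftZero : equivariantShift 𝒢 0 ≅ 𝟭 _ :=
  NatIso.ofComponents
    (fun X => mkIso ((shiftFunctorZero D ℤ).app X.obj) fun g => by
      have h := NatIso.naturality_1 (shiftFunctorZero D ℤ) (X.lam g).hom
      change (𝒢.F g).map ((shiftFunctorZero D ℤ).hom.app X.obj) ≫ (X.lam g).hom =
        (((𝒢.F g).commShiftIso (0 : ℤ)).hom.app X.obj ≫ (X.lam g).hom⟦(0 : ℤ)⟧') ≫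
          (shiftFunctorZero D ℤ).hom.app X.obj
      rw [Functor.commShiftIso_zero, Functor.CommShift.isoZero_hom_app, Category.assoc,
        Category.assoc, h, Functor.id_map])
    (fun f => hom_ext ((shiftFunctorZero D ℤ).hom.naturality f.hom))

/-- The isomorphism `X⟦n + m⟧ ≅ X⟦n⟧⟦m⟧` in `D^G`. -/
def equivariantShiftAdd (n m : ℤ) :
    equivariantShift 𝒢 (n + m) ≅ equivariantShift 𝒢 n ⋙ equivariantShift 𝒢 m :=
  NatIso.ofComponents
    (fun X => mkIso ((shiftFunctorAdd D n m).app X.obj) fun g => by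
      have h := NatIso.naturality_1 (shiftFunctorAdd D n m) (X.lam g).hom
      change (𝒢.F g).map ((shiftFunctorAdd D n m).hom.app X.obj) ≫
          ((𝒢.F g).commShiftIso m).hom.app (X.obj⟦n⟧) ≫
            (((𝒢.F g).commShiftIso n).hom.app X.obj ≫ (X.lam g).hom⟦n⟧')⟦m⟧' =
        (((𝒢.F g).commShiftIso (n + m)).hom.app X.obj ≫ (X.lam g).hom⟦n + m⟧') ≫
          (shiftFunctorAdd D n m).hom.app X.obj
      rw [Functor.commShiftIso_add, Functor.CommShift.isoAdd_hom_app]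
      simp only [Category.assoc]
      rw [h, Functor.comp_map, Functor.map_comp])
    (fun f => hom_ext ((shiftFunctorAdd D n m).hom.naturality f.hom))

instance : HasShift (EquivariantObject 𝒢) ℤ :=
  hasShiftMk _ _
    { F := equivariantShift 𝒢
      zero := equivariantShiftZero 𝒢
      add := equivariantShiftAdd 𝒢
      assoc_hom_app := fun n m l X => hom_ext <| by
        simp only [comp_hom, eqToHom_hom]
        have := shiftFunctorAdd_assoc_hom_app (C := D) n m l X.obj
        simp only [shiftFunctorAdd', Iso.trans_hom, eqToIso.hom, NatTrans.comp_app,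
          eqToHom_app, Category.assoc] at this
        exact this
      zero_add_hom_app := fun n X => hom_ext <| by
        simp only [comp_hom, eqToHom_hom]
        exact shiftFunctorAdd_zero_add_hom_app n X.obj
      add_zero_hom_app := fun n X => hom_ext <| by
        simp only [comp_hom, eqToHom_hom]
        exact shiftFunctorAdd_add_zero_hom_app n X.obj }

instance (n : ℤ) : (shiftFunctor (EquivariantObject 𝒢) n).Additive where
  map_add {_ _ f f'} := hom_ext ((shiftFunctor D n).map_add (f := f.hom) (g := f'.hom))

/-- The equality `ω(X⟦n⟧) = ω(X)⟦n⟧`. -/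
def forgetShiftIso (n : ℤ) :
    shiftFunctor (EquivariantObject 𝒢) n ⋙ forget 𝒢 ≅ forget 𝒢 ⋙ shiftFunctor D n :=
  Iso.refl _

lemma forgetShiftIso_hom_app (n : ℤ) (X : EquivariantObject 𝒢) :
    (forgetShiftIso 𝒢 n).hom.app X = 𝟙 (X.obj⟦n⟧) := rfl

instance : (forget 𝒢).CommShift ℤ where
  commShiftIso n := forgetShiftIso 𝒢 n
  commShiftIso_zero := by
    ext X
    rw [Functor.CommShift.isoZero_hom_app]
    exact ((shiftFunctorZero D ℤ).hom_inv_id_app X.obj).symm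
  commShiftIso_add n m := by
    ext X
    rw [Functor.CommShift.isoAdd_hom_app]
    have h : (shiftFunctorAdd D n m).hom.app X.obj ≫ 𝟙 _ ≫ (𝟙 (X.obj⟦n⟧))⟦m⟧' ≫
        (shiftFunctorAdd D n m).inv.app X.obj = 𝟙 _ := by
      rw [CategoryTheory.Functor.map_id, Category.id_comp]
      erw [Category.id_comp]
      exact (shiftFunctorAdd D n m).hom_inv_id_app X.obj
    exact h.symm

end Triangulated

section Tilting

variable {D : Type u} [Category.{v} D] [Preadditive D] [HasZeroObject D]
  [HasShift D ℤ] [∀ n : ℤ, (shiftFunctor D n).Additive] [Pretriangulated D]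

/-- A tilting object `T` of a triangulated category: `Hom(T, T⟦n⟧) = 0` for every `n ≠ 0`, and
`T` classically generates the category, i.e. the thick closure of `T` is everything. -/
structure IsTilting (T : D) : Prop where
  hom_eq_zero : ∀ n : ℤ, n ≠ 0 → ∀ f : T ⟶ T⟦n⟧, f = 0
  generates : (ObjectProperty.singleton T).IsClassicalTriangulatedGenerator

end Tilting

/-- The right global dimension of a ring: the supremum of the projective dimensions of its right
modules, i.e. of the (left) modules over the opposite ring. -/
def rightGlobalDimension (R : Type u) [Ring R] : WithBot ℕ∞ :=
  ⨆ M : ModuleCat.{u} Rᵐᵒᵖ, projectiveDimension M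

/-- Two rings are Morita equivalent if their categories of right modules (i.e. of modules over the
opposite rings) are equivalent as additive categories. -/
def MoritaEquivalentRings (R : Type u) [Ring R] (S : Type v) [Ring S] : Prop :=
  IsMoritaEquivalent ℤ Rᵐᵒᵖ Sᵐᵒᵖ

end Equivariantization

end

open Equivariantization

/-!
Put `Q = End (ω (Ind T))`, so that `End (Ind T)` is the ring of invariants `Q^G`. The projections
of `ω (Ind T)` onto its summands `F_h T` are orthogonal idempotents of `Q` which `G` permutes simply
transitively. Hence `Q` is free over `Q^G` with these idempotents as a basis, and the skew group
ring `QG`, acting on `Q`, becomes the matrix ring `M_G(Q^G)`; this is the Morita equivalence.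

If `R → S` is split by a map of `R`-bimodules and `S` is projective over `R`, every `R`-module is a
direct summand of a restricted `S`-module, so `gl.dim R ≤ gl.dim S`. Averaging over `G` splits
`Q^G → Q`, and the coefficient at `1` splits `Q → QG ≃ M_G(Q^G)`, so `gl.dim Q^G = gl.dim Q`. Since
`T` is `G`-invariant, `ω (Ind T)` is a sum of copies of `T`: this gives `Q ≃ M_G(End T)`, which
has the global dimension of `End T`, and the vanishing of `Hom(Ind T, (Ind T)⟦n⟧)` for `n ≠ 0`.

Generation: `Ind` is left adjoint to `ω`, hence exact, so the thick closure of `Ind T` contains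
every `Ind A`; and every `X` is a direct summand of `Ind (ω X)` because `|G|` is invertible.
-/

noncomputable section

namespace Equivariantization

section ProjectiveDimension

variable {C : Type*} [Category* C] [Abelian C] {C' : Type*} [Category* C'] [Abelian C']

lemma hasProjectiveDimensionLT_obj [EnoughProjectives C] (F : C ⥤ C') [F.Additive]
    [PreservesFiniteLimits F] [PreservesFiniteColimits F] [F.PreservesProjectiveObjects]
    (n : ℕ) (X : C) (hX : HasProjectiveDimensionLT X n) :
    HasProjectiveDimensionLT (F.obj X) n := by
  induction n generalizing X with
  | zero =>
    rw [hasProjectiveDimensionLT_zero_iff_isZero] at hX ⊢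
    exact F.map_isZero hX
  | succ n ih =>
    obtain _ | n := n
    · rw [zero_add, ← projective_iff_hasProjectiveDimensionLT_one] at hX ⊢
      infer_instance
    · obtain ⟨P⟩ := EnoughProjectives.presentation X
      have syzygy_exact : (ShortComplex.mk _ _ (kernel.condition P.f)).ShortExact :=
        { exact := ShortComplex.exact_kernel P.f }
      have : Projective (F.obj P.p) := inferInstance
      exact ((syzygy_exact.map_of_exact F).hasProjectiveDimensionLT_X₃_iff n this).2
        (ih _ ((syzygy_exact.hasProjectiveDimensionLT_X₃_iff n P.projective).1 hX))

lemma projectiveDimension_obj_le [EnoughProjectives C] (F : C ⥤ C') [F.Additive]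
    [PreservesFiniteLimits F] [PreservesFiniteColimits F] [F.PreservesProjectiveObjects] (X : C) :
    projectiveDimension (F.obj X) ≤ projectiveDimension X :=
  sInf_le_sInf fun _ hn i hi => hasProjectiveDimensionLT_obj F i X (hn i hi)

lemma iSup_projectiveDimension_le_of_retract [EnoughProjectives C] (F : C ⥤ C') [F.Additive]
    [PreservesFiniteLimits F] [PreservesFiniteColimits F] [F.PreservesProjectiveObjects]
    (h : ∀ Y : C', ∃ X : C, Nonempty (Retract Y (F.obj X))) :
    ⨆ Y : C', projectiveDimension Y ≤ ⨆ X : C, projectiveDimension X := by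
  refine iSup_le fun Y => ?_
  obtain ⟨X, ⟨r⟩⟩ := h Y
  exact r.projectiveDimension_le.trans
    ((projectiveDimension_obj_le F X).trans (le_iSup (fun X : C => projectiveDimension X) X))

lemma iSup_projectiveDimension_eq_of_equivalence [EnoughProjectives C] [EnoughProjectives C']
    (e : C ≌ C') : ⨆ X : C, projectiveDimension X = ⨆ Y : C', projectiveDimension Y := by
  have : e.functor.Additive := Functor.additive_of_preserves_binary_products _
  have : e.inverse.Additive := Functor.additive_of_preserves_binary_products _
  exact le_antisymm
    (iSup_projectiveDimension_le_of_retract e.inverse fun X =>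
      ⟨e.functor.obj X, ⟨.ofIso (e.unitIso.app X)⟩⟩)
    (iSup_projectiveDimension_le_of_retract e.functor fun Y =>
      ⟨e.inverse.obj Y, ⟨.ofIso (e.counitIso.app Y).symm⟩⟩)

end ProjectiveDimension

section GlobalDimension

lemma projective_of_finite_dualBasis {R M : Type*} [Ring R] [AddCommGroup M] [Module R M]
    {ι : Type*} [Fintype ι] (x : ι → M) (θ : ι → M →ₗ[R] R) (hθ : ∀ m, ∑ i, θ i m • x i = m) :
    Module.Projective R M :=
  .of_split (LinearMap.pi θ) (Fintype.linearCombination R x) (LinearMap.ext hθ)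

variable {R S : Type u} [Ring R] [Ring S]

lemma preservesProjectiveObjects_restrictScalars (f : R →+* S)
    [Module.Projective R ((ModuleCat.restrictScalars.{u} f).obj (ModuleCat.of S S))] :
    (ModuleCat.restrictScalars.{u} f).PreservesProjectiveObjects := by
  have : (ModuleCat.coextendScalars.{u, u, u} f).PreservesEpimorphisms := ⟨fun {M N} g hg => by
    rw [ModuleCat.epi_iff_surjective] at hg ⊢
    intro φ
    obtain ⟨ψ, hψ⟩ := Module.projective_lifting_property g.hom
      (ModuleCat.CoextendScalars.equiv f N φ) hg
    exact ⟨(ModuleCat.CoextendScalars.equiv f M).symm ψ, ModuleCat.CoextendScalars.ext hψ⟩⟩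
  exact ⟨fun h => (ModuleCat.restrictCoextendScalarsAdj.{u, u, u} f).map_projective _ h⟩

/-- A retraction `S → R` of `R`-bimodules of a ring homomorphism `R → S`. It makes every
`R`-module a direct summand of the restriction of an `S`-module. -/
structure BimoduleRetraction (f : R →+* S) extends S →+ R where
  map_mul_left : ∀ r s, toFun (f r * s) = r * toFun s
  map_mul_right : ∀ r s, toFun (s * f r) = toFun s * r
  map_one : toFun 1 = 1

namespace BimoduleRetraction

variable {f : R →+* S} (π : BimoduleRetraction f)

/-- A retraction of bimodules, seen as a retraction for the opposite rings. -/
def op : BimoduleRetraction f.op where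
  toAddMonoidHom := AddMonoidHom.mulOp π.toAddMonoidHom
  map_mul_left r s := MulOpposite.unop_injective (π.map_mul_right r.unop s.unop)
  map_mul_right r s := MulOpposite.unop_injective (π.map_mul_left r.unop s.unop)
  map_one := MulOpposite.unop_injective π.map_one

/-- The `R`-linear map `s ↦ π s • m` attached to an element `m` of an `R`-module. -/
def smulRight {M : ModuleCat.{u} R} (m : M) :
    (ModuleCat.restrictScalars.{u} f).obj (ModuleCat.of S S) →ₗ[R] M where
  toFun := fun s : S => π.toFun s • m
  map_add' := fun (s s' : S) => (congrArg (· • m) (π.map_add' s s')).trans (add_smul _ _ _)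
  map_smul' := fun r (s : S) => (congrArg (· • m) (π.map_mul_left r s)).trans (mul_smul _ _ _)

/-- Every `R`-module `M` is a direct summand of `Hom_R(S, M)`. -/
def retractCoextendScalars (M : ModuleCat.{u} R) :
    Retract M ((ModuleCat.restrictScalars.{u} f).obj
      ((ModuleCat.coextendScalars.{u, u, u} f).obj M)) where
  i := ModuleCat.ofHom
    (Y := (ModuleCat.restrictScalars f).obj ((ModuleCat.coextendScalars f).obj M))
    { toFun m := (ModuleCat.CoextendScalars.equiv f M).symm (π.smulRight m)
      map_add' m m' := ModuleCat.CoextendScalars.ext (LinearMap.ext fun s : S =>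
        smul_add (π.toFun s) m m')
      map_smul' r m := ModuleCat.CoextendScalars.ext (LinearMap.ext fun s : S =>
        (mul_smul (π.toFun s) r m).symm.trans
          (congrArg (· • m) (π.map_mul_right r s).symm)) }
  r := (ModuleCat.restrictCoextendScalarsAdj.{u, u, u} f).counit.app M
  retract := by
    ext m
    change π.toFun 1 • m = m
    rw [π.map_one, one_smul]

include π in
lemma iSup_projectiveDimension_le
    [Module.Projective R ((ModuleCat.restrictScalars.{u} f).obj (ModuleCat.of S S))] :
    ⨆ M : ModuleCat.{u} R, projectiveDimension M ≤
      ⨆ N : ModuleCat.{u} S, projectiveDimension N := by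
  have := preservesProjectiveObjects_restrictScalars f
  have : PreservesFiniteLimits (ModuleCat.restrictScalars.{u} f) := ⟨fun J _ _ => ⟨inferInstance⟩⟩
  have : PreservesFiniteColimits (ModuleCat.restrictScalars.{u} f) :=
    ⟨fun J _ _ => ⟨inferInstance⟩⟩
  exact iSup_projectiveDimension_le_of_retract (ModuleCat.restrictScalars.{u} f) fun M =>
    ⟨_, ⟨π.retractCoextendScalars M⟩⟩

include π in
lemma rightGlobalDimension_le {ι : Type*} [Fintype ι] (x : ι → S) (θ : ι → S →+ R)
    (θ_right : ∀ i r s, θ i (s * f r) = θ i s * r) (hθ : ∀ s, ∑ i, x i * f (θ i s) = s) :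
    rightGlobalDimension R ≤ rightGlobalDimension S := by
  have : Module.Projective Rᵐᵒᵖ
      ((ModuleCat.restrictScalars.{u} f.op).obj (ModuleCat.of Sᵐᵒᵖ Sᵐᵒᵖ)) :=
    projective_of_finite_dualBasis (fun i => (MulOpposite.op (x i) : Sᵐᵒᵖ))
      (fun i =>
        { AddMonoidHom.mulOp (θ i) with
          map_smul' := fun r (s : Sᵐᵒᵖ) =>
            MulOpposite.unop_injective (θ_right i r.unop s.unop) })
      fun s : Sᵐᵒᵖ => MulOpposite.unop_injective ((Finset.unop_sum _ _).trans (hθ s.unop))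
  exact π.op.iSup_projectiveDimension_le

end BimoduleRetraction

lemma rightGlobalDimension_congr (e : R ≃+* S) :
    rightGlobalDimension R = rightGlobalDimension S :=
  iSup_projectiveDimension_eq_of_equivalence
    (ModuleCat.restrictScalarsEquivalenceOfRingEquiv e.symm.op)

lemma rightGlobalDimension_eq_of_equiv_matrix {ι : Type*} [Fintype ι] [Nonempty ι]
    (e : S ≃+* Matrix ι ι R) : rightGlobalDimension S = rightGlobalDimension R := by
  classical
  have : Nonempty (Fin (Fintype.card ι)) := .map (Fintype.equivFin ι) inferInstance
  rw [rightGlobalDimension_congr (e.trans (Matrix.reindexRingEquiv R (Fintype.equivFin ι)))]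
  exact (iSup_projectiveDimension_eq_of_equivalence
    ((ModuleCat.matrixEquivalence.{u, 0} Rᵐᵒᵖ (Classical.arbitrary (Fin (Fintype.card ι)))).trans
      (ModuleCat.restrictScalarsEquivalenceOfRingEquiv RingEquiv.mopMatrix.symm))).symm

end GlobalDimension

section Morita

open scoped ModuleCat.Algebra in
lemma isMoritaEquivalent_of_algEquiv_matrix (k : Type*) [CommRing k] {A : Type v}
    {B : Type max v w} [Ring A] [Ring B] [Algebra k A] [Algebra k B] {ι : Type w} [Fintype ι]
    [DecidableEq ι] [Nonempty ι] (e : Matrix ι ι A ≃ₐ[k] B) : IsMoritaEquivalent k A B :=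
  let toMatrix := moritaEquivalenceMatrix.{v, w} A k (Classical.arbitrary ι)
  let ofMatrix := MoritaEquivalence.ofAlgEquiv e
  ⟨⟨{ eqv := toMatrix.eqv.trans ofMatrix.eqv
      linear := Functor.instLinearComp toMatrix.eqv.functor ofMatrix.eqv.functor }⟩⟩

lemma moritaEquivalentRings_of_equiv_matrix {R : Type v} {S : Type max v w} [Ring R] [Ring S]
    {ι : Type w} [Fintype ι] [Nonempty ι] (e : S ≃+* Matrix ι ι R) :
    MoritaEquivalentRings R S := by
  classical
  exact isMoritaEquivalent_of_algEquiv_matrix ℤ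
    (e.op.trans RingEquiv.mopMatrix.symm).symm.toIntAlgEquiv

end Morita

section InvariantTrace

variable {G Q : Type*} [Group G] [Fintype G] [Ring Q] [MulSemiringAction G Q]

variable (G) in
/-- The trace map from a ring with an action of a finite group to the ring of invariants. -/
def invariantTrace : Q →+ FixedPoints.subring Q G where
  toFun q := ⟨∑ g : G, g • q, fun h => by
    rw [Finset.smul_sum]
    exact Fintype.sum_equiv (Equiv.mulLeft h) _ _ fun g => smul_smul h g q⟩
  map_zero' := Subtype.ext (by simp)
  map_add' q q' := Subtype.ext (by simp [Finset.sum_add_distrib])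

lemma coe_invariantTrace (q : Q) : (invariantTrace G q : Q) = ∑ g : G, g • q := rfl

lemma invariantTrace_mul_coe (q : Q) (s : FixedPoints.subring Q G) :
    invariantTrace G (q * s) = invariantTrace G q * s :=
  Subtype.ext <| by
    simp only [coe_invariantTrace, Subring.coe_mul, smul_mul', s.2 _, Finset.sum_mul]

lemma invariantTrace_coe_mul (s : FixedPoints.subring Q G) (q : Q) :
    invariantTrace G (s * q) = s * invariantTrace G q :=
  Subtype.ext <| by
    simp only [coe_invariantTrace, Subring.coe_mul, smul_mul', s.2 _, Finset.mul_sum]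

/-- Averaging over a finite group whose order is invertible. -/
def averaging (hG : IsUnit (Nat.card G : FixedPoints.subring Q G)) :
    BimoduleRetraction (FixedPoints.subring Q G).subtype where
  toAddMonoidHom := (AddMonoidHom.mulLeft (↑hG.unit⁻¹ : FixedPoints.subring Q G)).comp
    (invariantTrace G)
  map_mul_left s q := by
    have inv_comm : Commute (↑hG.unit⁻¹) s :=
      Commute.units_inv_left (u := hG.unit) (Nat.cast_commute _ s)
    change _ * invariantTrace G (s * q) = s * (_ * invariantTrace G q)
    rw [invariantTrace_coe_mul, inv_comm.left_comm]
  map_mul_right s q := by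
    change _ * invariantTrace G (q * s) = _ * invariantTrace G q * s
    rw [invariantTrace_mul_coe, mul_assoc]
  map_one := by
    have trace_one : invariantTrace G (1 : Q) = (Nat.card G : FixedPoints.subring Q G) :=
      Subtype.ext (by simp [coe_invariantTrace])
    change _ * invariantTrace G (1 : Q) = 1
    rw [trace_one]
    exact hG.val_inv_mul

end InvariantTrace

section SkewGroupRing

lemma rightGlobalDimension_le_of_skewMonoidAlgebra_equiv {G : Type*} {Q S : Type v} [Group G]
    [Finite G] [Ring Q] [Ring S] [MulSemiringAction G Q] (e : SkewMonoidAlgebra Q G ≃+* S) :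
    rightGlobalDimension Q ≤ rightGlobalDimension S := by
  have := Fintype.ofFinite G
  let coeffHom (g : G) : S →+ Q := AddMonoidHom.mk' (fun s => (e.symm s).coeff g) (by simp)
  let π : BimoduleRetraction ((e : SkewMonoidAlgebra Q G →+* S).comp
      SkewMonoidAlgebra.singleOneRingHom) :=
    { coeffHom 1 with
      map_mul_left r s := by
        change (e.symm (e (.single 1 r) * s)).coeff 1 = r * (e.symm s).coeff 1
        rw [map_mul, e.symm_apply_apply, SkewMonoidAlgebra.coeff_single_one_mul]
      map_mul_right r s := by
        change (e.symm (s * e (.single 1 r))).coeff 1 = (e.symm s).coeff 1 * r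
        rw [map_mul, e.symm_apply_apply, SkewMonoidAlgebra.coeff_mul_single_one, one_smul]
      map_one := by
        change (e.symm 1).coeff 1 = 1
        rw [map_one e.symm, SkewMonoidAlgebra.coeff_one, Finsupp.single_eq_same] }
  refine π.rightGlobalDimension_le (fun g : G => e (.single g 1))
    (fun g => (DistribSMul.toAddMonoidHom Q g⁻¹).comp (coeffHom g)) (fun g r s => ?_) (fun s => ?_)
  · change g⁻¹ • (e.symm (s * e (.single 1 r))).coeff g = g⁻¹ • (e.symm s).coeff g * r
    rw [map_mul, e.symm_apply_apply, SkewMonoidAlgebra.coeff_mul_single_one, smul_mul',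
      inv_smul_smul]
  · change ∑ g, e (.single g 1) * e (.single 1 (g⁻¹ • (e.symm s).coeff g)) = s
    simp only [← map_mul, SkewMonoidAlgebra.single_mul_single, mul_one, one_mul, smul_inv_smul,
      ← map_sum]
    rw [← e.eq_symm_apply, ← Finsupp.sum_fintype _ _ SkewMonoidAlgebra.single_zero]
    exact SkewMonoidAlgebra.sum_single _

/-- A system of imprimitivity for the action of `G` on `Q` which is regular: a complete family of
orthogonal idempotents of `Q` indexed by `G` on which `G` acts by right translations. -/
structure RegularImprimitivity {G Q : Type*} [Group G] [Fintype G] [Ring Q]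
    [MulSemiringAction G Q] (p : G → Q) : Prop extends CompleteOrthogonalIdempotents p where
  smul_eq : ∀ g h, g • p h = p (h * g⁻¹)

namespace RegularImprimitivity

variable {G Q : Type*} [Group G] [Fintype G] [Ring Q] [MulSemiringAction G Q] {p : G → Q}
  (H : RegularImprimitivity p)
include H

lemma mul_eq [DecidableEq G] (g h : G) : p g * p h = if g = h then p g else 0 := by
  split_ifs with hgh
  · rw [← hgh]
    exact H.idem g
  · exact H.ortho hgh

lemma sum_mul_right (g : G) : ∑ d, p (d * g) = 1 :=
  (Equiv.sum_comp (Equiv.mulRight g) p).trans H.complete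

lemma sum_mul_inv (d : G) : ∑ g, p (d * g⁻¹) = 1 :=
  (Equiv.sum_comp ((Equiv.inv G).trans (Equiv.mulLeft d)) p).trans H.complete

lemma mul_invariantTrace (c : G) (q : Q) : p c * invariantTrace G (p c * q) = p c * q := by
  classical
  rw [coe_invariantTrace, Finset.mul_sum, Finset.sum_eq_single 1]
  · rw [one_smul, ← mul_assoc, H.idem]
  · intro g _ hg
    rw [smul_mul', H.smul_eq, ← mul_assoc, H.mul_eq, if_neg (by simpa using hg), zero_mul]
  · simp

lemma sum_mul_invariantTrace (q : Q) : ∑ c, p c * invariantTrace G (p c * q) = q := by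
  simp only [H.mul_invariantTrace, ← Finset.sum_mul, H.complete, one_mul]

lemma invariantTrace_mul_eq [DecidableEq G] (c d : G) :
    invariantTrace G (p c * p d) = if c = d then 1 else 0 := by
  rw [H.mul_eq]
  split_ifs
  · exact Subtype.ext (by simp only [coe_invariantTrace, H.smul_eq, H.sum_mul_inv]; rfl)
  · exact map_zero _

lemma rightGlobalDimension_fixedPoints_le (hG : IsUnit (Nat.card G : FixedPoints.subring Q G)) :
    rightGlobalDimension (FixedPoints.subring Q G) ≤ rightGlobalDimension Q := by
  refine (averaging hG).rightGlobalDimension_le p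
    (fun c => (invariantTrace G).comp (AddMonoidHom.mulLeft (p c))) (fun c s q => ?_)
    H.sum_mul_invariantTrace
  change invariantTrace G (p c * (q * s)) = invariantTrace G (p c * q) * s
  rw [← mul_assoc, invariantTrace_mul_coe]

omit H in
variable (p) in
/-- The action `(a g) q = a (g • q)` of the skew group ring on `Q`, written as matrices in the
basis `p` of the right module `Q` over the ring of invariants. -/
def toMatrix : SkewMonoidAlgebra Q G →+ Matrix G G (FixedPoints.subring Q G) where
  toFun x := Matrix.of fun c d => invariantTrace G (p c * ∑ g, x.coeff g * p (d * g⁻¹))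
  map_zero' := by ext; simp
  map_add' x y := by
    ext
    simp [add_mul, Finset.sum_add_distrib, mul_add]

omit H in
lemma toMatrix_apply (x : SkewMonoidAlgebra Q G) (c d : G) :
    toMatrix p x c d = invariantTrace G (p c * ∑ g, x.coeff g * p (d * g⁻¹)) := rfl

omit H in
lemma toMatrix_single (g : G) (a : Q) (c d : G) :
    toMatrix p (SkewMonoidAlgebra.single g a) c d =
      invariantTrace G (p c * (a * p (d * g⁻¹))) := by
  classical
  rw [toMatrix_apply, Finset.sum_eq_single g]
  · simp
  · intro h _ hh
    simp [hh.symm]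
  · simp

lemma toMatrix_single_mul_single (g h : G) (a b : Q) :
    toMatrix p (SkewMonoidAlgebra.single g a * SkewMonoidAlgebra.single h b) =
      toMatrix p (SkewMonoidAlgebra.single g a) * toMatrix p (SkewMonoidAlgebra.single h b) := by
  refine Matrix.ext fun c d => ?_
  have expansion : g • (b * p (d * h⁻¹)) =
      ∑ m, p (m * g⁻¹) * invariantTrace G (p m * (b * p (d * h⁻¹))) := by
    conv_lhs => rw [← H.sum_mul_invariantTrace (b * p (d * h⁻¹))]
    simp only [Finset.smul_sum, smul_mul', H.smul_eq, (invariantTrace G _).2 g]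
  calc toMatrix p (SkewMonoidAlgebra.single g a * SkewMonoidAlgebra.single h b) c d
    _ = invariantTrace G (p c * (a * g • (b * p (d * h⁻¹)))) := by
      rw [SkewMonoidAlgebra.single_mul_single, toMatrix_single, smul_mul', H.smul_eq, mul_inv_rev,
        mul_assoc, mul_assoc]
    _ = ∑ m, invariantTrace G (p c * (a * p (m * g⁻¹))) *
          invariantTrace G (p m * (b * p (d * h⁻¹))) := by
      simp only [expansion, Finset.mul_sum, map_sum, ← invariantTrace_mul_coe, mul_assoc]
    _ = _ := by simp only [Matrix.mul_apply, toMatrix_single]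

lemma toMatrix_mul (x y : SkewMonoidAlgebra Q G) :
    toMatrix p (x * y) = toMatrix p x * toMatrix p y := by
  induction x with
  | add x x' hx hx' => simp only [add_mul, map_add, hx, hx']
  | single g a =>
    induction y with
    | add y y' hy hy' => simp only [mul_add, map_add, hy, hy']
    | single h b => exact H.toMatrix_single_mul_single g h a b

lemma toMatrix_injective : Function.Injective (toMatrix p) := by
  classical
  rw [injective_iff_map_eq_zero]
  intro x hx
  have apply_basis (d : G) : ∑ g, x.coeff g * p (d * g⁻¹) = 0 := by
    rw [← H.sum_mul_invariantTrace (∑ g, x.coeff g * p (d * g⁻¹))]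
    refine Finset.sum_eq_zero fun c _ => ?_
    rw [← toMatrix_apply, hx, Matrix.zero_apply, ZeroMemClass.coe_zero, mul_zero]
  refine SkewMonoidAlgebra.coeff_injective (Finsupp.ext fun h => ?_)
  have coeff_mul (d : G) : x.coeff h * p (d * h⁻¹) = 0 := by
    simpa [Finset.sum_mul, mul_assoc, H.mul_eq] using congrArg (· * p (d * h⁻¹)) (apply_basis d)
  rw [← mul_one (x.coeff h), ← H.sum_mul_right h⁻¹, Finset.mul_sum]
  exact Finset.sum_eq_zero fun d _ => coeff_mul d

lemma toMatrix_surjective : Function.Surjective (toMatrix p) := by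
  classical
  intro M
  refine ⟨⟨Finsupp.equivFunOnFinite.symm fun g => ∑ c, ∑ d, p c * M c d * p (d * g⁻¹)⟩, ?_⟩
  have coeff_mul (d g : G) :
      (∑ a, ∑ b, p a * M a b * p (b * g⁻¹)) * p (d * g⁻¹) = (∑ a, p a * M a d) * p (d * g⁻¹) := by
    simp [Finset.sum_mul, mul_assoc, H.mul_eq]
  refine Matrix.ext fun c d => ?_
  rw [toMatrix_apply]
  simp only [Finsupp.equivFunOnFinite_symm_apply_apply, coeff_mul, ← Finset.mul_sum,
    H.sum_mul_inv, mul_one]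
  simp [Finset.mul_sum, ← mul_assoc, invariantTrace_mul_coe, H.invariantTrace_mul_eq]

/-- The skew group ring is the ring of matrices over the ring of invariants. -/
def skewEquivMatrix : SkewMonoidAlgebra Q G ≃+* Matrix G G (FixedPoints.subring Q G) :=
  { Equiv.ofBijective (toMatrix p) ⟨H.toMatrix_injective, H.toMatrix_surjective⟩ with
    map_mul' := H.toMatrix_mul
    map_add' := map_add (toMatrix p) }

lemma rightGlobalDimension_le_fixedPoints :
    rightGlobalDimension Q ≤ rightGlobalDimension (FixedPoints.subring Q G) := by
  classical
  let n := Fintype.equivFin G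
  have : Nonempty (Fin (Fintype.card G)) := .map n inferInstance
  rw [← rightGlobalDimension_eq_of_equiv_matrix
    (.refl (Matrix (Fin (Fintype.card G)) (Fin (Fintype.card G)) (FixedPoints.subring Q G)))]
  exact rightGlobalDimension_le_of_skewMonoidAlgebra_equiv
    (H.skewEquivMatrix.trans (Matrix.reindexRingEquiv _ n))

lemma rightGlobalDimension_fixedPoints
    (hG : IsUnit (Nat.card G : FixedPoints.subring Q G)) :
    rightGlobalDimension (FixedPoints.subring Q G) = rightGlobalDimension Q :=
  (H.rightGlobalDimension_fixedPoints_le hG).antisymm H.rightGlobalDimension_le_fixedPoints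

end RegularImprimitivity

end SkewGroupRing

section Preadditive

variable {A : Type u} [Category.{v} A] [Preadditive A]

lemma IsInvertibleIn.isUnit_natCast {n : ℕ} (hn : IsInvertibleIn n A) (X : A) :
    IsUnit (n : End X) := by
  obtain ⟨e : End X, he, -⟩ := hn (𝟙 X)
  have mul_eq_one : (n : End X) * e = 1 := (nsmul_eq_mul n e).symm.trans he
  exact ⟨⟨n, e, mul_eq_one, (Nat.cast_commute n e).symm.eq.trans mul_eq_one⟩, rfl⟩

lemma IsInvertibleIn.equivariantObject {n : ℕ} (hn : IsInvertibleIn n A) {G : Type*} [Group G]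
    (𝒢 : GroupAction G A) : IsInvertibleIn n (EquivariantObject 𝒢) := by
  intro X Y f
  obtain ⟨e, he, he_unique⟩ := hn f.hom
  have smul_hom (φ : X ⟶ Y) : (n • φ).hom = n • φ.hom := (forget 𝒢).map_nsmul (f := φ)
  have conj_e (g : G) : conj (X := X) (Y := Y) g e = e := he_unique _ <| by
    change n • AddMonoidHom.mk' (conj (X := X) (Y := Y) g) (conj_add g) e = f.hom
    rw [← map_nsmul, he]
    exact f.invariant g
  refine ⟨⟨e, conj_e⟩, hom_ext ((smul_hom _).trans he), fun φ hφ => hom_ext (he_unique _ ?_)⟩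
  change n • φ.hom = f.hom
  rw [← smul_hom, hφ]

lemma hom_eq_zero_of_isBilimit {ι κ : Type*} [Finite ι] [Finite κ] {X : ι → A} {Y : κ → A}
    {b : Bicone X} {c : Bicone Y} (hb : b.IsBilimit) (hc : c.IsBilimit)
    {B : Type*} [Category* B] [Preadditive B] (F F' : A ⥤ B) [F.Additive] [F'.Additive]
    (h : ∀ i j (f : F.obj (X i) ⟶ F'.obj (Y j)), f = 0) (f : F.obj b.pt ⟶ F'.obj c.pt) :
    f = 0 := by
  have := Fintype.ofFinite ι
  have := Fintype.ofFinite κ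
  calc f = F.map (∑ i, b.π i ≫ b.ι i) ≫ f ≫ F'.map (∑ j, c.π j ≫ c.ι j) := by
        simp [IsBilimit.total hb, IsBilimit.total hc]
    _ = ∑ j, ∑ i, F.map (b.π i) ≫ (F.map (b.ι i) ≫ f ≫ F'.map (c.π j)) ≫ F'.map (c.ι j) := by
        simp [Preadditive.sum_comp, Preadditive.comp_sum]
    _ = 0 := by simp [h]

/-- The endomorphism ring of a direct sum of copies of `T` is a matrix ring over `End T`; the
entry `(k, l)` is the component from the `l`-th to the `k`-th summand. -/
def endEquivMatrix {ι : Type*} [Fintype ι] {T : A} {b : Bicone fun _ : ι => T} (hb : b.IsBilimit) :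
    End b.pt ≃+* Matrix ι ι (End T) where
  toFun f := Matrix.of fun k l => b.ι l ≫ f ≫ b.π k
  invFun M := ∑ k, ∑ l, b.π l ≫ M k l ≫ b.ι k
  left_inv f :=
    calc ∑ k, ∑ l, b.π l ≫ (b.ι l ≫ f ≫ b.π k) ≫ b.ι k
      _ = (∑ l, b.π l ≫ b.ι l) ≫ f ≫ ∑ k, b.π k ≫ b.ι k := by
        simp [Preadditive.sum_comp, Preadditive.comp_sum]
      _ = f := by simp [IsBilimit.total hb]
  right_inv M := by
    classical
    ext k l
    change b.ι l ≫ (∑ i, ∑ j, b.π j ≫ M i j ≫ b.ι i) ≫ b.π k = M k l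
    simp [Preadditive.sum_comp, Preadditive.comp_sum, b.ι_π, reassoc_of% b.ι_π, ite_comp,
      comp_ite]
  map_mul' f f' := by
    ext k l
    rw [Matrix.mul_apply]
    calc b.ι l ≫ (f' ≫ f) ≫ b.π k
      _ = b.ι l ≫ f' ≫ (∑ m, b.π m ≫ b.ι m) ≫ f ≫ b.π k := by simp [IsBilimit.total hb]
      _ = ∑ m, (b.ι l ≫ f' ≫ b.π m) ≫ (b.ι m ≫ f ≫ b.π k) := by
        simp only [Preadditive.sum_comp, Preadditive.comp_sum, Category.assoc]
  map_add' f f' := by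
    ext k l
    change b.ι l ≫ (f + f') ≫ b.π k = b.ι l ≫ f ≫ b.π k + b.ι l ≫ f' ≫ b.π k
    rw [Preadditive.add_comp, Preadditive.comp_add]

end Preadditive

section Induction

variable {G : Type w} [Group G] {A : Type u} [Category.{v} A] [Preadditive A]

/-- The endomorphisms of an equivariant object are the `G`-invariant endomorphisms of its
underlying object. -/
def endEquivFixedPoints {𝒢 : GroupAction G A} (X : EquivariantObject 𝒢) :
    End X ≃+* FixedPoints.subring (End X.obj) G where
  toFun f := ⟨f.hom, fun g => f.invariant g⁻¹⟩
  invFun q := ⟨q.1, fun g => by simpa only [smul_end_def, inv_inv] using q.2 g⁻¹⟩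
  left_inv _ := rfl
  right_inv _ := rfl
  map_mul' _ _ := rfl
  map_add' _ _ := rfl

variable [Finite G] [HasFiniteBiproducts A] (𝒢 : GroupAction G A)

/-- The inclusion of the summand `F_h T` of `ω (Ind T)`. -/
def indι (T : A) (h : G) : (𝒢.F h).obj T ⟶ ((Ind 𝒢).obj T).obj :=
  biproduct.ι (fun h : G => (𝒢.F h).obj T) h

/-- The projection of `ω (Ind T)` onto the summand `F_h T`. -/
def indπ (T : A) (h : G) : ((Ind 𝒢).obj T).obj ⟶ (𝒢.F h).obj T :=
  biproduct.π (fun h : G => (𝒢.F h).obj T) h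

lemma indι_indπ_self (T : A) (h : G) : indι 𝒢 T h ≫ indπ 𝒢 T h = 𝟙 _ :=
  biproduct.ι_π_self _ _

lemma indι_indπ_ne (T : A) {g h : G} (hgh : g ≠ h) : indι 𝒢 T g ≫ indπ 𝒢 T h = 0 :=
  biproduct.ι_π_ne _ hgh

lemma sum_indπ_indι [Fintype G] (T : A) :
    ∑ h, indπ 𝒢 T h ≫ indι 𝒢 T h = 𝟙 ((Ind 𝒢).obj T).obj :=
  IsBilimit.total (biproduct.isBilimit fun h : G => (𝒢.F h).obj T)

lemma ind_hom_ext {T Y : A} {f f' : ((Ind 𝒢).obj T).obj ⟶ Y}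
    (w : ∀ h, indι 𝒢 T h ≫ f = indι 𝒢 T h ≫ f') : f = f' :=
  biproduct.hom_ext' _ _ w

lemma map_ind_hom_ext {T Y : A} {g : G} {f f' : (𝒢.F g).obj ((Ind 𝒢).obj T).obj ⟶ Y}
    (w : ∀ h, (𝒢.F g).map (indι 𝒢 T h) ≫ f = (𝒢.F g).map (indι 𝒢 T h) ≫ f') : f = f' :=
  map_biproduct_hom_ext 𝒢 T Y g w

lemma map_indι_lam (T : A) (g h : G) :
    (𝒢.F g).map (indι 𝒢 T h) ≫ (((Ind 𝒢).obj T).lam g).hom =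
      (𝒢.δ g h).hom.app T ≫ indι 𝒢 T (h * g) :=
  ι_indLam 𝒢 T g h

lemma indι_map {T T' : A} (f : T ⟶ T') (h : G) :
    indι 𝒢 T h ≫ ((Ind 𝒢).map f).hom = (𝒢.F h).map f ≫ indι 𝒢 T' h :=
  biproduct.ι_map (fun h : G => (𝒢.F h).map f) h

variable {𝒢} in
/-- The inclusions into and projections from `ω (Ind T)` of the summands `F_g T`, identified with
`T`. -/
def indBicone {T : A} (e : ∀ g, (𝒢.F g).obj T ≅ T) : Bicone fun _ : G => T where
  pt := ((Ind 𝒢).obj T).obj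
  π g := indπ 𝒢 T g ≫ (e g).hom
  ι g := (e g).inv ≫ indι 𝒢 T g
  ι_π g h := by
    split_ifs with hgh
    · subst hgh
      simp [reassoc_of% indι_indπ_self 𝒢 T g]
    · simp [reassoc_of% indι_indπ_ne 𝒢 T hgh]

variable {𝒢} in
/-- `ω (Ind T)` is a biproduct of copies of a `G`-invariant object `T`. -/
def isBilimitIndBicone [Fintype G] {T : A} (e : ∀ g, (𝒢.F g).obj T ≅ T) :
    (indBicone e).IsBilimit :=
  isBilimitOfTotal _ <| (Finset.sum_congr rfl fun g _ => by simp [indBicone]).trans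
    (sum_indπ_indι 𝒢 T)

/-- The idempotent endomorphism of `ω (Ind T)` attached to the summand `F_h T`. -/
def indIdempotent (T : A) (h : G) : End ((Ind 𝒢).obj T).obj :=
  indπ 𝒢 T h ≫ indι 𝒢 T h

lemma conj_indIdempotent (T : A) (g h : G) :
    conj (X := (Ind 𝒢).obj T) (Y := (Ind 𝒢).obj T) g (indIdempotent 𝒢 T h) =
      indIdempotent 𝒢 T (h * g) := by
  rw [conj_eq_iff]
  refine map_ind_hom_ext 𝒢 fun k => ?_
  rw [reassoc_of% map_indι_lam, ← Functor.map_comp_assoc, indIdempotent, indIdempotent]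
  by_cases hkh : k = h
  · subst hkh
    rw [reassoc_of% indι_indπ_self, reassoc_of% indι_indπ_self, map_indι_lam]
  · rw [reassoc_of% indι_indπ_ne 𝒢 T hkh,
      reassoc_of% indι_indπ_ne 𝒢 T (mul_left_injective g |>.ne hkh)]
    simp

lemma regularImprimitivity_indIdempotent [Fintype G] (T : A) :
    RegularImprimitivity (indIdempotent 𝒢 T) where
  toCompleteOrthogonalIdempotents :=
    CompleteOrthogonalIdempotents.iff_ortho_complete.2
      ⟨fun g h hgh => by
        change (indπ 𝒢 T h ≫ indι 𝒢 T h) ≫ indπ 𝒢 T g ≫ indι 𝒢 T g = 0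
        simp [reassoc_of% indι_indπ_ne 𝒢 T hgh.symm], sum_indπ_indι 𝒢 T⟩
  smul_eq g h := conj_indIdempotent 𝒢 T g⁻¹ h

variable {𝒢}

/-- The morphism on underlying objects of `indDesc`. -/
def indDescHom {T : A} {X : EquivariantObject 𝒢} (f : T ⟶ X.obj) :
    ((Ind 𝒢).obj T).obj ⟶ X.obj :=
  biproduct.desc fun h => (𝒢.F h).map f ≫ (X.lam h).hom

lemma indι_indDescHom {T : A} {X : EquivariantObject 𝒢} (f : T ⟶ X.obj) (h : G) :
    indι 𝒢 T h ≫ indDescHom f = (𝒢.F h).map f ≫ (X.lam h).hom :=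
  biproduct.ι_desc _ _

/-- The morphism `Ind T ⟶ X` which corresponds to `f : T ⟶ ω X`. -/
def indDesc {T : A} {X : EquivariantObject 𝒢} (f : T ⟶ X.obj) : (Ind 𝒢).obj T ⟶ X :=
  mkHom (indDescHom f) fun g => by
    refine map_ind_hom_ext 𝒢 fun h => ?_
    rw [reassoc_of% map_indι_lam 𝒢 T g h, ← Functor.map_comp_assoc, indι_indDescHom,
      indι_indDescHom, Functor.map_comp, Category.assoc, X.comm]
    exact (𝒢.δ g h).hom.naturality_assoc f _

lemma indι_indDesc {T : A} {X : EquivariantObject 𝒢} (f : T ⟶ X.obj) (h : G) :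
    indι 𝒢 T h ≫ (indDesc f).hom = (𝒢.F h).map f ≫ (X.lam h).hom :=
  indι_indDescHom f h

lemma indDesc_comp {T : A} {X Y : EquivariantObject 𝒢} (f : T ⟶ X.obj) (φ : X ⟶ Y) :
    indDesc f ≫ φ = indDesc (f ≫ φ.hom) := by
  refine hom_ext (ind_hom_ext 𝒢 fun h => ?_)
  rw [comp_hom, reassoc_of% indι_indDesc f h, indι_indDesc, Functor.map_comp, Category.assoc,
    hom_comm]

lemma map_indDesc {T T' : A} {X : EquivariantObject 𝒢} (f : T ⟶ T') (f' : T' ⟶ X.obj) :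
    (Ind 𝒢).map f ≫ indDesc f' = indDesc (f ≫ f') := by
  refine hom_ext (ind_hom_ext 𝒢 fun h => ?_)
  rw [comp_hom, reassoc_of% indι_map 𝒢 f h, indι_indDesc, indι_indDesc, Functor.map_comp,
    Category.assoc]

lemma indDesc_injective (T : A) (X : EquivariantObject 𝒢) :
    Function.Injective (indDesc : (T ⟶ X.obj) → ((Ind 𝒢).obj T ⟶ X)) := fun f f' h =>
  (𝒢.F 1).map_injective <| (cancel_mono (X.lam 1).hom).1 <| by
    rw [← indι_indDesc, ← indι_indDesc, h]

lemma indDesc_surjective (T : A) (X : EquivariantObject 𝒢) :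
    Function.Surjective (indDesc : (T ⟶ X.obj) → ((Ind 𝒢).obj T ⟶ X)) := by
  intro φ
  obtain ⟨f, hf⟩ := (𝒢.F 1).map_surjective (indι 𝒢 T 1 ≫ φ.hom ≫ (X.lam 1).inv)
  have eq_on_one : (𝒢.F 1).map f ≫ (X.lam 1).hom = indι 𝒢 T 1 ≫ φ.hom := by simp [hf]
  have eq_on_one_mul (h : G) :
      (𝒢.F (1 * h)).map f ≫ (X.lam (1 * h)).hom = indι 𝒢 T (1 * h) ≫ φ.hom := by
    rw [← cancel_epi ((𝒢.δ h 1).hom.app T)]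
    calc (𝒢.δ h 1).hom.app T ≫ (𝒢.F (1 * h)).map f ≫ (X.lam (1 * h)).hom
      _ = (𝒢.F h).map ((𝒢.F 1).map f) ≫ (𝒢.δ h 1).hom.app X.obj ≫ (X.lam (1 * h)).hom :=
        ((𝒢.δ h 1).hom.naturality_assoc f _).symm
      _ = (𝒢.F h).map (indι 𝒢 T 1 ≫ φ.hom) ≫ (X.lam h).hom := by
        rw [← X.comm, ← Functor.map_comp_assoc, eq_on_one]
      _ = (𝒢.δ h 1).hom.app T ≫ indι 𝒢 T (1 * h) ≫ φ.hom := by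
        rw [Functor.map_comp, Category.assoc, hom_comm, reassoc_of% map_indι_lam 𝒢 T h 1]
  refine ⟨f, hom_ext (ind_hom_ext 𝒢 fun h => ?_)⟩
  rw [indι_indDesc, ← one_mul h, eq_on_one_mul]

/-- The bijection `Hom(T, ω X) ≃ Hom(Ind T, X)`. -/
def indDescEquiv (T : A) (X : EquivariantObject 𝒢) : (T ⟶ X.obj) ≃ ((Ind 𝒢).obj T ⟶ X) :=
  .ofBijective indDesc ⟨indDesc_injective T X, indDesc_surjective T X⟩

variable (𝒢) in
/-- Induction is left adjoint to the forgetful functor. -/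
def indAdjunction : Ind 𝒢 ⊣ forget 𝒢 :=
  .mkOfHomEquiv
    { homEquiv := fun T X => (indDescEquiv T X).symm
      homEquiv_naturality_left_symm := fun f f' => (map_indDesc f f').symm
      homEquiv_naturality_right := fun {T X Y} φ ψ =>
        (indDescEquiv T Y).symm_apply_eq.2 <|
          (congrArg (· ≫ ψ) ((indDescEquiv T X).apply_symm_apply φ)).symm.trans
            (indDesc_comp _ ψ) }

/-- The morphism `X ⟶ Ind (ω X)` with components `λ_h⁻¹ : ω X ⟶ F_h (ω X)`. -/
def toIndForget [Fintype G] (X : EquivariantObject 𝒢) : X ⟶ (Ind 𝒢).obj X.obj :=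
  mkHom (∑ h, (X.lam h).inv ≫ indι 𝒢 X.obj h) fun g => by
    rw [Functor.map_sum, Preadditive.sum_comp, Preadditive.comp_sum]
    refine Fintype.sum_equiv (Equiv.mulRight g) _ _ fun h => ?_
    have lam_comm := X.comm g h
    rw [Functor.map_comp, Category.assoc, map_indι_lam,
      ← cancel_epi ((𝒢.F g).map (X.lam h).hom), ← Functor.map_comp_assoc, Iso.hom_inv_id,
      reassoc_of% lam_comm]
    simp

lemma toIndForget_indDesc [Fintype G] (X : EquivariantObject 𝒢) :
    toIndForget X ≫ indDesc (𝟙 X.obj) = Nat.card G • 𝟙 X := by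
  refine hom_ext (Eq.trans ?_ ((forget 𝒢).map_nsmul (f := 𝟙 X)).symm)
  change (∑ h, (X.lam h).inv ≫ indι 𝒢 X.obj h) ≫ (indDesc (𝟙 X.obj)).hom = Nat.card G • 𝟙 X.obj
  simp [Preadditive.sum_comp, indι_indDesc]

lemma nonempty_retract_ind (hG : IsInvertibleIn (Nat.card G) A) (X : EquivariantObject 𝒢) :
    Nonempty (Retract X ((Ind 𝒢).obj X.obj)) := by
  have := Fintype.ofFinite G
  obtain ⟨e, he, -⟩ := hG.equivariantObject 𝒢 (𝟙 X)
  refine ⟨⟨toIndForget X, indDesc (𝟙 X.obj) ≫ e, ?_⟩⟩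
  rw [reassoc_of% toIndForget_indDesc X, Preadditive.nsmul_comp, Category.id_comp, he]

end Induction

section Triangulated

lemma isClassicalTriangulatedGenerator_of_retract {C D : Type*} [Category* C] [Category* D]
    [Preadditive C] [HasZeroObject C] [HasShift C ℤ] [∀ n : ℤ, (shiftFunctor C n).Additive]
    [Pretriangulated C] [Preadditive D] [HasZeroObject D] [HasShift D ℤ]
    [∀ n : ℤ, (shiftFunctor D n).Additive] [Pretriangulated D] [IsTriangulated D]
    (L : C ⥤ D) [L.CommShift ℤ] [L.IsTriangulated]
    (hL : ∀ Y, ∃ X, Nonempty (Retract Y (L.obj X))) {P : ObjectProperty C}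
    {P' : ObjectProperty D} [P'.Nonempty] (hPP' : P ≤ P'.inverseImage L)
    (hP : P.IsClassicalTriangulatedGenerator) : P'.IsClassicalTriangulatedGenerator := by
  have : (P'.triangEnvelope.inverseImage L).IsStableUnderRetracts :=
    ⟨fun r hY => P'.triangEnvelope.prop_of_retract (r.map L) hY⟩
  have envelope_le : P.triangEnvelope ≤ P'.triangEnvelope.inverseImage L :=
    (ObjectProperty.triangEnvelope_le_iff _).2 fun X hX =>
      ObjectProperty.le_triangEnvelope _ _ (hPP' X hX)
  rw [ObjectProperty.isClassicalTriangulatedGenerator_iff] at hP ⊢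
  refine eq_top_iff.2 fun Y _ => ?_
  obtain ⟨X, ⟨r⟩⟩ := hL Y
  exact P'.triangEnvelope.prop_of_retract r (envelope_le X (hP ▸ trivial))

variable {G : Type w} [Group G] [Finite G]
  {D : Type u} [Category.{v} D] [Preadditive D] [HasZeroObject D] [HasShift D ℤ]
  [∀ n : ℤ, (shiftFunctor D n).Additive] [Pretriangulated D]
  {𝒢 : GroupAction G D} [AdmissibleAction 𝒢]

lemma ind_hom_shift_eq_zero {T : D} (hinv : 𝒢.IsInvariant T) {n : ℤ}
    (hT : ∀ f : T ⟶ T⟦n⟧, f = 0) (f : (Ind 𝒢).obj T ⟶ ((Ind 𝒢).obj T)⟦n⟧) : f = 0 := by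
  have := Fintype.ofFinite G
  let hb := isBilimitIndBicone fun g => (hinv g).some
  exact hom_ext (hom_eq_zero_of_isBilimit hb hb (𝟭 D) (shiftFunctor D n) (fun _ _ => hT) f.hom)

variable [Pretriangulated (EquivariantObject 𝒢)] [IsTriangulated (EquivariantObject 𝒢)]
  [(forget 𝒢).IsTriangulated]

lemma isClassicalTriangulatedGenerator_ind (hG : IsInvertibleIn (Nat.card G) D) {T : D}
    (hT : (ObjectProperty.singleton T).IsClassicalTriangulatedGenerator) :
    (ObjectProperty.singleton ((Ind 𝒢).obj T)).IsClassicalTriangulatedGenerator := by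
  let := (indAdjunction 𝒢).leftAdjointCommShift ℤ
  have := (indAdjunction 𝒢).commShift_of_rightAdjoint ℤ
  have := (indAdjunction 𝒢).isTriangulated_leftAdjoint
  exact isClassicalTriangulatedGenerator_of_retract (Ind 𝒢)
    (fun X => ⟨X.obj, nonempty_retract_ind hG X⟩)
    ((ObjectProperty.singleton_le_iff).2 (by simp)) hT

lemma isTilting_ind (hG : IsInvertibleIn (Nat.card G) D) {T : D} (hT : IsTilting T)
    (hinv : 𝒢.IsInvariant T) : IsTilting ((Ind 𝒢).obj T) where
  hom_eq_zero n hn := ind_hom_shift_eq_zero hinv (hT.hom_eq_zero n hn)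
  generates := isClassicalTriangulatedGenerator_ind hG hT.generates

end Triangulated

end Equivariantization

end

theorem mainTheorem9_general {G : Type w} [Group G] [Finite G]
    {D : Type u} [Category.{v} D] [Preadditive D] [HasZeroObject D] [HasShift D ℤ]
    [∀ n : ℤ, (shiftFunctor D n).Additive] [Pretriangulated D]
    (𝒢 : GroupAction G D) [AdmissibleAction 𝒢]
    (hG : IsInvertibleIn (Nat.card G) D)
    [Pretriangulated (EquivariantObject 𝒢)] [IsTriangulated (EquivariantObject 𝒢)]
    [(forget 𝒢).IsTriangulated]
    (T : D) (hT : IsTilting T) (hinv : 𝒢.IsInvariant T) :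
    IsTilting ((Ind 𝒢).obj T) ∧
      MoritaEquivalentRings (End ((Ind 𝒢).obj T)) (SkewGroupRing ((Ind 𝒢).obj T)) ∧
      rightGlobalDimension (End ((Ind 𝒢).obj T)) = rightGlobalDimension (End T) := by
  classical
  have := Fintype.ofFinite G
  have H := regularImprimitivity_indIdempotent 𝒢 T
  let invariants := endEquivFixedPoints ((Ind 𝒢).obj T)
  have card_isUnit := ((hG.equivariantObject 𝒢).isUnit_natCast ((Ind 𝒢).obj T)).map invariants
  rw [map_natCast] at card_isUnit
  refine ⟨isTilting_ind hG hT hinv,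
    moritaEquivalentRings_of_equiv_matrix (H.skewEquivMatrix.trans invariants.symm.mapMatrix), ?_⟩
  calc rightGlobalDimension (End ((Ind 𝒢).obj T))
    _ = rightGlobalDimension (FixedPoints.subring (End ((Ind 𝒢).obj T).obj) G) :=
      rightGlobalDimension_congr invariants
    _ = rightGlobalDimension (End ((Ind 𝒢).obj T).obj) :=
      H.rightGlobalDimension_fixedPoints card_isUnit
    _ = rightGlobalDimension (End T) :=
      rightGlobalDimension_eq_of_equiv_matrix
        (endEquivMatrix (isBilimitIndBicone fun g => (hinv g).some))

theorem mainTheorem9 {G : Type w} [Group G] [Finite G]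
    {D : Type u} [Category.{v} D] [Preadditive D] [HasZeroObject D] [HasShift D ℤ]
    [∀ n : ℤ, (shiftFunctor D n).Additive] [Pretriangulated D] [IsTriangulated D]
    [IsIdempotentComplete D]
    (𝒢 : GroupAction G D) [AdmissibleAction 𝒢]
    (hG : IsInvertibleIn (Nat.card G) D)
    [Pretriangulated (EquivariantObject 𝒢)] [IsTriangulated (EquivariantObject 𝒢)]
    [(forget 𝒢).IsTriangulated]
    (T : D) (hT : IsTilting T) (hinv : 𝒢.IsInvariant T) :
    IsTilting ((Ind 𝒢).obj T) ∧
      MoritaEquivalentRings (End ((Ind 𝒢).obj T)) (SkewGroupRing ((Ind 𝒢).obj T)) ∧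
      rightGlobalDimension (End ((Ind 𝒢).obj T)) = rightGlobalDimension (End T) :=
  mainTheorem9_general 𝒢 hG T hT hinv
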